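/- Let $(G,c)$ be a resistance network: a connected graph with vertex set $V$ and conductances $c_{xy}=c_{yx}\ge 0$ with $c_{xx}=0$, where $x\sim y$ iff $c_{xy}>0$, and $c(x)=\sum_y c_{xy}<\infty$ for every $x\in V$ (infinite degrees are allowed). For functions $v:V\to\mathbb R$ put $$(\Delta v)(x)=\sum_y c_{xy}(v(x)-v(y)),\qquad \mathcal E(v)=\tfrac12\sum_{x,y}c_{xy}(v(x)-v(y))^2,\qquad \operatorname{dom}\mathcal E=\{v:\mathcal E(v)<\infty\}.$$ Let $\mathrm{Fin}\subseteq\operatorname{dom}\mathcal E$ be the closure, in the energy seminorm $\mathcal E^{1/2}$, of the functions that are constant outside a finite set. A unit flow from $x$ to $y$ is an antisymmetric function $I$ on $V\times V$, vanishing where $c$ vanishes, with $\sum_t I(s,t)=\delta_x(s)-\delta_y(s)$ for all $s$; the set of these is $\mathcal F(x,y)$. The dissipation of $I$ is $D(I)=\tfrac12\sum_{c_{st}>0}c_{st}^{-1}I(s,t)^2$. For a finite $H\subseteq V$, the wired network $H^W$ has vertex set $H\cup\{\infty\}$, conductances $c_{ab}$ for $a,b\in H$, and $c_{a\infty}=\sum_{z\notin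 H}c_{az}$. Let $R_{H^W}(x,y)$ be the effective resistance in $H^W$, that is, $v(x)-v(y)$ where $v$ is a function on $H^W$ with $\Delta v=\delta_x-\delta_y$. An exhaustion is an increasing sequence of finite sets $G_k$ with union $V$, each inducing a connected subgraph. **Theorem.** Let $x,y\in V$. Exhaustions exist, and the limit $R^W(x,y)=\lim_{k\to\infty}R_{G_k^W}(x,y)$ exists and is the same for every exhaustion $(G_k)$. Moreover: 1. There are $v\in\mathrm{Fin}$ with $\Delta v=\delta_x-\delta_y$, and every such $v$ satisfies $v(x)-v(y)=R^W(x,y)$. Also $v(x)-v(y)=R^W(x,y)$ for every $v$ of minimal energy in $\{v\in\operatorname{dom}\mathcal E:\Delta v=\delta_x-\delta_y\}$. If every harmonic $h\in\operatorname{dom}\mathcal E$ satisfies $h(x)=h(y)$, then $R^W(x,y)=\min\{v(x)-v(y):\Delta v=\delta_x-\delta_y,\ v\in\operatorname{dom}\mathcal E\}$. 2. $R^W(x,y)=\min\{\mathcal E(v):\Delta v=\delta_x-\delta_y,\ v\in\operatorname{dom}\mathcal E\}$. 3. $R^W(x,y)=\min\{D(I): I\in\mathcal F(x,y),\ D(I)<\infty\}$.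 4. If $x\ne y$, then $R^W(x,y)>0$ and $R^W(x,y)=1/\min\{\mathcal E(u):u(x)=1,\ u(y)=0,\ u\in\mathrm{Fin}\}$. 5. $R^W(x,y)=\inf\{\kappa\ge0: |v(x)-v(y)|^2\le\kappa\,\mathcal E(v)\text{ for all }v\in\mathrm{Fin}\}$. 6. $R^W(x,y)=\sup\{|v(x)-v(y)|^2:\mathcal E(v)\le1,\ v\in\mathrm{Fin}\}$. The quantity in 5 and 6 is the square of the norm of $L_{xy}:v\mapsto v(x)-v(y)$ on $\mathrm{Fin}$. -/

import Mathlib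

open Filter Topology

noncomputable section

namespace ResistanceNetwork

/-- The graph of a conductance function: distinct vertices `x`, `y` are adjacent iff
`c x y > 0` (for symmetric `c`). -/
def conductanceGraph {V : Type*} (c : V → V → ℝ) : SimpleGraph V :=
  SimpleGraph.fromRel (fun x y => 0 < c x y)

/-- A resistance network: a connected graph on `V` given by a symmetric nonnegative conductance
function without loops and with finite total conductance at every vertex. Infinite degrees and
unbounded total conductances are allowed. -/
structure Network (V : Type*) where
  c : V → V → ℝ
  symm : ∀ x y, c x y = c y x
  nonneg : ∀ x y, 0 ≤ c x y
  loopless : ∀ x, c x x = 0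
  summable : ∀ x, Summable (fun y => c x y)
  connected : (conductanceGraph c).Connected

section General

variable {V : Type*} (c : V → V → ℝ)

/-- The Dirac mass at `x`. -/
def dirac (x : V) : V → ℝ := Set.indicator {x} (fun _ => (1 : ℝ))

/-- The Laplacian `(Δ v)(x) = ∑_y c_{xy} (v(x) - v(y))`. The sum converges absolutely
for `v` of finite energy when all total conductances are finite. -/
def laplacian (v : V → ℝ) (x : V) : ℝ := ∑' y, c x y * (v x - v y)

/-- The function `v` has finite energy. -/
def FiniteEnergy (v : V → ℝ) : Prop :=
  Summable (fun p : V × V => c p.1 p.2 * (v p.1 - v p.2) ^ 2)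

/-- The energy of `v`, to be used for `v` of finite energy. -/
def energy (v : V → ℝ) : ℝ :=
  (1 / 2) * ∑' p : V × V, c p.1 p.2 * (v p.1 - v p.2) ^ 2

/-- `v` has finite energy and solves `Δ v = δ_x - δ_y`. -/
def IsDipole (x y : V) (v : V → ℝ) : Prop :=
  FiniteEnergy c v ∧ ∀ z, laplacian c v z = dirac x z - dirac y z

/-- `h` is harmonic of finite energy. -/
def IsHarmonic (h : V → ℝ) : Prop :=
  FiniteEnergy c h ∧ ∀ z, laplacian c h z = 0

/-- `u` is constant off a finite set, that is, finitely supported modulo constants. -/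
def FinitelySupported (u : V → ℝ) : Prop :=
  ∃ k : ℝ, {z | u z ≠ k}.Finite

/-- The space `Fin`: functions of finite energy in the closure, with respect to the energy
seminorm, of the functions that are finitely supported modulo constants. -/
def FinSpace : Set (V → ℝ) :=
  {v | FiniteEnergy c v ∧ ∀ ε > 0, ∃ u, FiniteEnergy c u ∧ FinitelySupported u ∧
    energy c (fun z => v z - u z) < ε}

/-- A current: an antisymmetric function on pairs of vertices supported on the edges. -/
structure IsCurrent (I : V → V → ℝ) : Prop where
  antisymm : ∀ s t, I s t = - I t s
  supported : ∀ s t, c s t = 0 → I s t = 0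

/-- The current `I` has finite dissipation. -/
def FiniteDissipation (I : V → V → ℝ) : Prop :=
  Summable (fun p : V × V => (c p.1 p.2)⁻¹ * I p.1 p.2 ^ 2)

/-- The dissipation of a current. Pairs that are not edges contribute `0`, since a current
vanishes there. -/
def dissipation (I : V → V → ℝ) : ℝ :=
  (1 / 2) * ∑' p : V × V, (c p.1 p.2)⁻¹ * I p.1 p.2 ^ 2

/-- `I` is a unit current flow from `x` to `y`: it satisfies `∑_t I(s,t) = δ_x(s) - δ_y(s)`. The
sums converge absolutely for currents of finite dissipation. -/
def IsFlow (x y : V) (I : V → V → ℝ) : Prop :=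
  IsCurrent c I ∧ ∀ s, ∑' t, I s t = dirac x s - dirac y s

/-- Effective resistance in a finite network: the voltage drop `v(x) - v(y)` when a unit current is
inserted at `x` and withdrawn at `y`, that is, when `Δ v = δ_x - δ_y`. On a finite network
in which `x` and `y` are connected, the set below has exactly one element. -/
def effectiveResistance [Finite V] (x y : V) : ℝ :=
  sInf {d | ∃ v : V → ℝ, (∀ z, laplacian c v z = dirac x z - dirac y z) ∧ d = v x - v y}

/-- The conductances of the wired subnetwork `H^W`, with vertex set `H ∪ {∞}` (`∞` is `none`): the
full subnetwork on `H`, with all vertices outside `H` identified to `∞`. -/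
def wiredConductance (H : Finset V) : Option {a // a ∈ H} → Option {a // a ∈ H} → ℝ
  | some a, some b => c a b
  | some a, none => ∑' z : {z // z ∉ H}, c a z
  | none, some b => ∑' z : {z // z ∉ H}, c b z
  | none, none => 0

open Classical in
/-- The vertex of `H^W` to which a vertex of the network is sent. -/
def wiredVertex (H : Finset V) (x : V) : Option {a // a ∈ H} :=
  if h : x ∈ H then some ⟨x, h⟩ else none

/-- The effective resistance `R_{H^W}(x,y)` in the wired subnetwork. -/
def wiredSubnetworkResistance (H : Finset V) (x y : V) : ℝ :=
  effectiveResistance (wiredConductance c H) (wiredVertex H x) (wiredVertex H y)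

/-- An exhaustion: an increasing sequence of finite connected full subnetworks (given by their
vertex sets) whose union is the whole network. -/
structure IsExhaustion (G : ℕ → Finset V) : Prop where
  mono : Monotone G
  connected : ∀ k, ((conductanceGraph c).induce (G k : Set V)).Connected
  exhausts : ∀ z, ∃ k, z ∈ G k

/-- `R` is the wired resistance between `x` and `y`: exhaustions exist, and along each
of them the resistances of the wired subnetworks converge to `R`. -/
def IsWiredResistance (x y : V) (R : ℝ) : Prop :=
  (∃ G, IsExhaustion c G) ∧
  ∀ G, IsExhaustion c G →
    Tendsto (fun k => wiredSubnetworkResistance c (G k) x y) atTop (𝓝 R)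

end General

end ResistanceNetwork

end

noncomputable section

namespace ResistanceNetwork

/-! The weighted gradient `√c (v s - v t)` embeds functions of finite energy, modulo constants, in
the Hilbert space `ℓ²(V × V)`, with energy half the squared norm. By connectedness there is a vector
`η` with `⟪η, grad v⟫ = 2 (v x - v y)`. Pairing with the gradient of `δ_z` gives `2 Δ v z`, so the
dipole equation on a set `S` says that `η - grad v` is orthogonal to the Dirac gradients on `S`.

Functions on the wired network `H^W` are functions on `V` constant off `H`, and their gradients span
exactly the Dirac gradients on `H`. Hence, for `x, y ∈ H`, solving the wired problem is projecting
`η` onto that span (`wiredSubnetworkResistance_eq`). Along an exhaustion these projections converge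
to the projection onto the closure of all Dirac gradients, which is the image of `Fin`. The limit is
the gradient of a dipole `f`, and `R` is both its voltage drop and its energy (`exists_finDipole`).

Every dipole, and every unit flow of finite dissipation, differs from `grad f` by a vector
orthogonal to that closure, so Pythagoras gives the minima. On `Fin`, pairing with `grad f` computes
the drop, and Cauchy–Schwarz, sharp at multiples of `f`, gives the remaining formulas. -/

/-- The Hilbert space of square-summable functions on pairs of vertices. -/
abbrev EdgeSpace (V : Type*) := lp (fun _ : V × V => ℝ) 2

theorem memℓp_two_iff {ι : Type*} {f : ι → ℝ} :
    Memℓp f 2 ↔ Summable fun i => f i ^ 2 := by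
  rw [memℓp_gen_iff (by norm_num)]
  simp

theorem inner_lp_eq {ι : Type*} (f g : lp (fun _ : ι => ℝ) 2) :
    inner ℝ f g = ∑' i, f i * g i := by
  rw [lp.inner_eq_tsum]
  exact tsum_congr fun i => by simp [mul_comm]

theorem summable_lp_mul {ι : Type*} (f g : lp (fun _ : ι => ℝ) 2) :
    Summable fun i => f i * g i :=
  (lp.summable_inner (𝕜 := ℝ) f g).congr fun i => by simp [mul_comm]

theorem dirac_apply {V : Type*} [DecidableEq V] (x z : V) :
    dirac x z = if z = x then 1 else 0 := by
  simp [dirac, Set.indicator_apply]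

/-! ### The gradient embedding and its pairing with Dirac masses -/

namespace Network

variable {V : Type*} (N : Network V)

theorem sqrt_mul_sqrt (p : V × V) : √(N.c p.1 p.2) * √(N.c p.1 p.2) = N.c p.1 p.2 :=
  Real.mul_self_sqrt (N.nonneg _ _)

theorem finiteEnergy_iff {v : V → ℝ} :
    FiniteEnergy N.c v ↔
      Memℓp (fun p : V × V => √(N.c p.1 p.2) * (v p.1 - v p.2)) 2 := by
  rw [memℓp_two_iff, FiniteEnergy]
  refine summable_congr fun p => ?_
  rw [mul_pow, Real.sq_sqrt (N.nonneg _ _)]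

/-- The functions of finite energy. -/
def finiteEnergySubmodule : Submodule ℝ (V → ℝ) where
  carrier := {v | FiniteEnergy N.c v}
  zero_mem' := by simp [FiniteEnergy, summable_zero]
  add_mem' {u v} hu hv := by
    simp only [Set.mem_ofPred_eq, finiteEnergy_iff] at *
    convert hu.add hv using 1
    ext p
    simp only [Pi.add_apply]
    ring
  smul_mem' a v hv := by
    simp only [Set.mem_ofPred_eq, finiteEnergy_iff] at *
    convert hv.const_smul a using 1
    ext p
    simp only [Pi.smul_apply, smul_eq_mul]
    ring

theorem mem_finiteEnergySubmodule {v : V → ℝ} :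
    v ∈ N.finiteEnergySubmodule ↔
      Memℓp (fun p : V × V => √(N.c p.1 p.2) * (v p.1 - v p.2)) 2 :=
  N.finiteEnergy_iff

/-- The weighted gradient, from functions of finite energy to the edge space. -/
def grad : N.finiteEnergySubmodule →ₗ[ℝ] EdgeSpace V where
  toFun v := ⟨fun p => √(N.c p.1 p.2) * (v.1 p.1 - v.1 p.2), N.finiteEnergy_iff.1 v.2⟩
  map_add' u v := by
    ext p
    simp only [lp.coeFn_add, Pi.add_apply, Submodule.coe_add]
    ring
  map_smul' a v := by
    ext p
    simp only [lp.coeFn_smul, Pi.smul_apply, Submodule.coe_smul, smul_eq_mul, RingHom.id_apply]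
    ring

@[simp]
theorem grad_apply (v : N.finiteEnergySubmodule) (p : V × V) :
    N.grad v p = √(N.c p.1 p.2) * (v.1 p.1 - v.1 p.2) := rfl

theorem energy_eq_norm_sq (v : N.finiteEnergySubmodule) :
    energy N.c v = 1 / 2 * ‖N.grad v‖ ^ 2 := by
  rw [← real_inner_self_eq_norm_sq, inner_lp_eq, energy]
  congr 1
  refine tsum_congr fun p => ?_
  nth_rw 1 [grad_apply, ← N.sqrt_mul_sqrt, grad_apply]
  ring

theorem memℓp_dirac_fst (z : V) :
    Memℓp (fun p : V × V => dirac z p.1 * √(N.c p.1 p.2)) 2 := by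
  classical
  rw [memℓp_two_iff]
  have hinj : Function.Injective (fun t : V => (z, t)) := fun a b h => (Prod.mk.inj h).2
  refine (hinj.summable_iff ?_).1 ?_
  · rintro ⟨s, t⟩ h
    have : s ≠ z := fun hs => h ⟨t, by simp [hs]⟩
    simp [dirac_apply, this]
  · refine (N.summable z).congr fun t => ?_
    simp [dirac_apply, Real.sq_sqrt (N.nonneg _ _)]

/-- The square roots of the conductances at `z`, as a function of the edges starting at `z`. -/
def star (z : V) : EdgeSpace V := ⟨_, N.memℓp_dirac_fst z⟩

@[simp]
theorem star_apply (z : V) (p : V × V) :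
    N.star z p = dirac z p.1 * √(N.c p.1 p.2) := rfl

theorem hasSum_mul_star (w : EdgeSpace V) (z : V) :
    HasSum (fun t => √(N.c z t) * w (z, t)) (inner ℝ w (N.star z)) := by
  classical
  have hinj : Function.Injective (fun t : V => (z, t)) := fun a b h => (Prod.mk.inj h).2
  have h := (summable_lp_mul w (N.star z)).hasSum
  rw [← inner_lp_eq, ← hinj.hasSum_iff] at h
  · convert h using 2 with t
    simp [dirac_apply, mul_comm]
  · rintro ⟨s, t⟩ h
    have : s ≠ z := fun hs => h ⟨t, by simp [hs]⟩
    simp [dirac_apply, this]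

theorem dirac_mem (z : V) : dirac z ∈ N.finiteEnergySubmodule := by
  rw [mem_finiteEnergySubmodule]
  have h := N.memℓp_dirac_fst z
  have h' : Memℓp (fun p : V × V => dirac z p.2 * √(N.c p.1 p.2)) 2 := by
    rw [memℓp_two_iff] at h ⊢
    rw [← (Equiv.prodComm V V).summable_iff] at h
    refine h.congr fun p => ?_
    simp [N.symm p.1 p.2]
  convert h.sub h' using 1
  ext p
  simp only [Pi.sub_apply]
  ring

/-- The gradient of the Dirac mass at `z`. -/
def diracGrad (z : V) : EdgeSpace V := N.grad ⟨dirac z, N.dirac_mem z⟩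

/-- Pairing an antisymmetric element of the edge space with the gradient of a Dirac mass gives
twice its divergence. -/
theorem inner_diracGrad {w : EdgeSpace V} (hw : ∀ s t, w (s, t) = -w (t, s)) (z : V) :
    inner ℝ w (N.diracGrad z) = 2 * ∑' t, √(N.c z t) * w (z, t) := by
  have h := (summable_lp_mul w (N.star z)).hasSum
  rw [← inner_lp_eq] at h
  -- The Dirac gradient is supported on the pairs leaving and entering `z`; by antisymmetry of `w`
  -- both halves contribute equally, hence the factor 2.
  have h' := (Equiv.prodComm V V).hasSum_iff.2 h
  have h2 := h.add h'
  rw [(N.hasSum_mul_star w z).tsum_eq, two_mul, inner_lp_eq, ← h2.tsum_eq]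
  refine tsum_congr fun ⟨s, t⟩ => ?_
  simp only [diracGrad, grad_apply, star_apply, Function.comp, Equiv.prodComm_apply, Prod.swap]
  rw [hw t s, N.symm t s]
  ring

theorem grad_antisymm (v : N.finiteEnergySubmodule) (s t : V) :
    N.grad v (s, t) = -N.grad v (t, s) := by
  simp only [grad_apply]
  rw [N.symm t s]
  ring

theorem inner_grad_diracGrad (v : N.finiteEnergySubmodule) (z : V) :
    inner ℝ (N.grad v) (N.diracGrad z) = 2 * laplacian N.c v z := by
  rw [N.inner_diracGrad (N.grad_antisymm v), laplacian]
  congr 1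
  refine tsum_congr fun t => ?_
  rw [grad_apply, ← mul_assoc, N.sqrt_mul_sqrt (z, t)]

theorem summable_laplacian (v : N.finiteEnergySubmodule) (z : V) :
    Summable fun t => N.c z t * (v.1 z - v.1 t) := by
  have h := (N.hasSum_mul_star (N.grad v) z).summable
  simp only [grad_apply, ← mul_assoc] at h
  exact h.congr fun t => by rw [N.sqrt_mul_sqrt (z, t)]

theorem const_mem (k : ℝ) : (fun _ => k) ∈ N.finiteEnergySubmodule := by
  change Summable fun p : V × V => N.c p.1 p.2 * (k - k) ^ 2
  simpa only [sub_self, ne_eq, two_ne_zero, not_false_eq_true, zero_pow, mul_zero] using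
    summable_zero

theorem grad_const (k : ℝ) : N.grad ⟨fun _ => k, N.const_mem k⟩ = 0 := by
  ext p
  simp

/-! ### `Fin` as a closed subspace of the edge space -/

/-- The span of the gradients of Dirac masses at points of `S`. -/
def diracSpan (S : Set V) : Submodule ℝ (EdgeSpace V) := Submodule.span ℝ (N.diracGrad '' S)

theorem diracSpan_mono {S T : Set V} (h : S ⊆ T) : N.diracSpan S ≤ N.diracSpan T :=
  Submodule.span_mono (Set.image_mono h)

theorem exists_of_mem_diracSpan {S : Set V} {w : EdgeSpace V} (hw : w ∈ N.diracSpan S) :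
    ∃ v : N.finiteEnergySubmodule, N.grad v = w ∧ {z | v.1 z ≠ 0}.Finite ∧ ∀ z ∉ S, v.1 z = 0 := by
  classical
  induction hw using Submodule.span_induction with
  | mem w h =>
    obtain ⟨z, hz, rfl⟩ := h
    refine ⟨⟨dirac z, N.dirac_mem z⟩, rfl, (Set.finite_singleton z).subset fun a ha => ?_,
      fun a ha => ?_⟩
    · by_contra hne
      exact ha (by simp only [dirac_apply]; exact if_neg hne)
    · have : a ≠ z := fun h => ha (h ▸ hz)
      simp [dirac_apply, this]
  | zero => exact ⟨0, map_zero _, by simp, by simp⟩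
  | add u w _ _ hu hw =>
    obtain ⟨f, rfl, hf, hf'⟩ := hu
    obtain ⟨g, rfl, hg, hg'⟩ := hw
    refine ⟨f + g, map_add _ _ _, (hf.union hg).subset fun z hz => ?_, fun z hz => ?_⟩
    · by_contra h
      simp only [Set.mem_union, Set.mem_ofPred_eq, not_or, not_not] at h
      exact hz (by simp [h.1, h.2])
    · simp [hf' z hz, hg' z hz]
  | smul a w _ hw =>
    obtain ⟨f, rfl, hf, hf'⟩ := hw
    refine ⟨a • f, map_smul _ _ _, hf.subset fun z hz h => hz (by simp [h]), fun z hz => ?_⟩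
    simp [hf' z hz]

theorem grad_mem_diracSpan_of_finset (H : Finset V) {v : V → ℝ} {k : ℝ}
    (hv : ∀ z ∉ H, v z = k) :
    ∃ h : v ∈ N.finiteEnergySubmodule, N.grad ⟨v, h⟩ ∈ N.diracSpan H := by
  classical
  set D : V → N.finiteEnergySubmodule := fun z => ⟨dirac z, N.dirac_mem z⟩ with hD
  have key : v = ((⟨fun _ => k, N.const_mem k⟩ + ∑ z ∈ H, (v z - k) • D z :
      N.finiteEnergySubmodule) : V → ℝ) := by
    ext a
    simp only [hD, Submodule.coe_add, Submodule.coe_sum, Submodule.coe_smul, Pi.add_apply,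
      Finset.sum_apply, Pi.smul_apply, dirac_apply, smul_eq_mul, mul_ite, mul_one, mul_zero,
      Finset.sum_ite_eq]
    split_ifs with h
    · ring
    · rw [hv a h, add_zero]
  have hmem : v ∈ N.finiteEnergySubmodule := by
    rw [key]
    exact Subtype.property _
  refine ⟨hmem, ?_⟩
  have : (⟨v, hmem⟩ : N.finiteEnergySubmodule) =
      ⟨fun _ => k, N.const_mem k⟩ + ∑ z ∈ H, (v z - k) • D z := Subtype.ext key
  rw [this, map_add, grad_const, zero_add, map_sum]
  refine Submodule.sum_mem _ fun z hz => ?_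
  rw [map_smul]
  exact Submodule.smul_mem _ _ (Submodule.subset_span ⟨z, hz, rfl⟩)

/-- The closure of the gradients of finitely supported functions. -/
def finClosure : Submodule ℝ (EdgeSpace V) := (N.diracSpan Set.univ).topologicalClosure

instance : N.finClosure.HasOrthogonalProjection :=
  haveI : CompleteSpace N.finClosure :=
    (Submodule.isClosed_topologicalClosure _).completeSpace_coe
  inferInstance

/-- Constants have zero gradient, so being constant off a finite set and being finitely supported
give the same gradients. -/
theorem mem_finSpace_iff (v : N.finiteEnergySubmodule) :
    v.1 ∈ FinSpace N.c ↔ N.grad v ∈ N.finClosure := by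
  rw [finClosure, ← SetLike.mem_coe, Submodule.topologicalClosure_coe, Metric.mem_closure_iff]
  have hen : ∀ u : N.finiteEnergySubmodule,
      energy N.c (fun z => v.1 z - u.1 z) = 1 / 2 * dist (N.grad v) (N.grad u) ^ 2 := fun u => by
    rw [dist_eq_norm, ← map_sub, ← energy_eq_norm_sq]
    rfl
  constructor
  · rintro ⟨-, h⟩ ε hε
    obtain ⟨u, hu, ⟨k, hk⟩, hlt⟩ := h (1 / 2 * ε ^ 2) (by positivity)
    obtain ⟨hmem, hspan⟩ := N.grad_mem_diracSpan_of_finset hk.toFinset (v := u) (k := k)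
      (fun z hz => by simpa using hz)
    refine ⟨_, N.diracSpan_mono (Set.subset_univ _) hspan, ?_⟩
    have := hen ⟨u, hmem⟩
    rw [this] at hlt
    exact lt_of_pow_lt_pow_left₀ 2 hε.le (by linarith)
  · intro h
    refine ⟨v.2, fun ε hε => ?_⟩
    obtain ⟨w, hw, hlt⟩ := h (√ε) (by positivity)
    obtain ⟨u, rfl, hu, -⟩ := N.exists_of_mem_diracSpan hw
    refine ⟨u, u.2, ⟨0, hu⟩, ?_⟩
    rw [hen]
    have := pow_lt_pow_left₀ hlt dist_nonneg (n := 2) two_ne_zero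
    rw [Real.sq_sqrt hε.le] at this
    linarith

/-! ### Voltage drops as bounded functionals -/

theorem adj_pos {x y : V} (h : (conductanceGraph N.c).Adj x y) : 0 < N.c x y := by
  rw [conductanceGraph, SimpleGraph.fromRel_adj] at h
  rcases h.2 with h | h
  · exact h
  · rwa [N.symm]

/-- The difference of the values at two points is represented by an element of the edge space. -/
theorem exists_inner_eq_sub (x y : V) :
    ∃ η : EdgeSpace V, ∀ v : N.finiteEnergySubmodule, inner ℝ η (N.grad v) = v.1 x - v.1 y := by
  classical
  obtain ⟨p⟩ := N.connected.preconnected x y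
  induction p with
  | nil => exact ⟨0, by simp⟩
  | @cons a b d hab _ ih =>
    obtain ⟨η, hη⟩ := ih
    have hpos := N.adj_pos hab
    -- The differences telescope along the walk; the coefficient cancels the weight `√c` of the
    -- gradient.
    refine ⟨lp.single 2 (a, b) (√(N.c a b))⁻¹ + η, fun v => ?_⟩
    rw [inner_add_left, hη, lp.inner_single_left]
    have : √(N.c a b) ≠ 0 := (Real.sqrt_pos.2 hpos).ne'
    simp only [grad_apply, RCLike.inner_apply, conj_trivial]
    field_simp
    ring

/-- Limits of gradients are gradients. -/
theorem exists_grad_eq_of_mem_finClosure {w : EdgeSpace V} (hw : w ∈ N.finClosure) :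
    ∃ v : N.finiteEnergySubmodule, N.grad v = w := by
  obtain ⟨o⟩ := N.connected.nonempty
  -- The potential of `w` normalized at `o` has to be `z ↦ ⟪η z, w⟫`. That its gradient is `w` is a
  -- closed condition, valid on the span.
  choose η hη using fun z => N.exists_inner_eq_sub z o
  have hcl : IsClosed {w : EdgeSpace V |
      ∀ p : V × V, √(N.c p.1 p.2) * (inner ℝ (η p.1) w - inner ℝ (η p.2) w) = w p} := by
    simp only [Set.ofPred_forall]
    refine isClosed_iInter fun p => isClosed_eq (by fun_prop) ?_
    exact (continuous_apply p).comp (lp.uniformContinuous_coe (p := 2)).continuous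
  have hsub : closure (N.diracSpan Set.univ : Set (EdgeSpace V)) ⊆ {w : EdgeSpace V |
      ∀ p : V × V, √(N.c p.1 p.2) * (inner ℝ (η p.1) w - inner ℝ (η p.2) w) = w p} := by
    refine closure_minimal (fun u hu => ?_) hcl
    obtain ⟨v, rfl, -⟩ := N.exists_of_mem_diracSpan hu
    intro p
    rw [hη, hη, grad_apply]
    ring
  have h := hsub hw
  have hmem : (fun z => inner ℝ (η z) w) ∈ N.finiteEnergySubmodule := by
    rw [mem_finiteEnergySubmodule]
    have hw' : Memℓp (fun p : V × V => w p) 2 := lp.memℓp w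
    exact (funext h : (fun p : V × V =>
      √(N.c p.1 p.2) * (inner ℝ (η p.1) w - inner ℝ (η p.2) w)) = fun p => w p) ▸ hw'
  refine ⟨⟨_, hmem⟩, lp.ext (funext fun p => ?_)⟩
  rw [grad_apply]
  exact h p

end Network

/-! ### Wired resistances as orthogonal projections -/

theorem dirac_comm {V : Type*} (x z : V) : dirac x z = dirac z x := by
  classical
  simp only [dirac_apply, eq_comm]

theorem sum_dirac {V : Type*} [Fintype V] (x : V) : ∑ z, dirac x z = 1 := by
  classical
  simp [dirac_apply]

theorem sum_laplacian_eq_zero {V : Type*} [Fintype V] {c : V → V → ℝ}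
    (hc : ∀ x y, c x y = c y x) (v : V → ℝ) : ∑ z, laplacian c v z = 0 := by
  simp only [laplacian, tsum_fintype]
  have h : ∑ z, ∑ y, c z y * (v z - v y) = -∑ z, ∑ y, c z y * (v z - v y) := by
    nth_rw 1 [Finset.sum_comm]
    simp only [← Finset.sum_neg_distrib]
    refine Finset.sum_congr rfl fun z _ => Finset.sum_congr rfl fun y _ => ?_
    rw [hc y z]
    ring
  linarith

theorem wiredVertex_of_mem {V : Type*} {H : Finset V} {z : V} (hz : z ∈ H) :
    wiredVertex H z = some ⟨z, hz⟩ := by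
  simp [wiredVertex, hz]

theorem wiredVertex_of_notMem {V : Type*} {H : Finset V} {z : V} (hz : z ∉ H) :
    wiredVertex H z = none := by
  simp [wiredVertex, hz]

theorem wiredConductance_comm {V : Type*} {c : V → V → ℝ} (hc : ∀ x y, c x y = c y x)
    (H : Finset V) (a b : Option {a // a ∈ H}) :
    wiredConductance c H a b = wiredConductance c H b a := by
  cases a <;> cases b <;> simp [wiredConductance, hc]

namespace Network

variable {V : Type*} (N : Network V)

/-- The pullback is constant off `H`, so the part of the Laplacian sum outside `H` collapses to a
single term whose coefficient is the conductance to `∞`. -/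
theorem laplacian_wired_some (H : Finset V) (g : Option {a // a ∈ H} → ℝ) (a : {a // a ∈ H}) :
    laplacian (wiredConductance N.c H) g (some a) =
      laplacian N.c (fun z => g (wiredVertex H z)) a := by
  obtain ⟨hmem, -⟩ := N.grad_mem_diracSpan_of_finset H (v := fun z => g (wiredVertex H z))
    (k := g none) fun z hz => by rw [wiredVertex_of_notMem hz]
  have hs := N.summable_laplacian ⟨_, hmem⟩ a
  rw [laplacian, laplacian, tsum_fintype, Fintype.sum_option, add_comm]
  refine Eq.trans ?_ (hs.sum_add_tsum_subtype_compl H)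
  congr 1
  · rw [← Finset.sum_coe_sort H]
    refine Finset.sum_congr rfl fun b _ => ?_
    simp [wiredConductance, wiredVertex_of_mem]
  · simp only [wiredConductance]
    rw [← tsum_mul_right]
    refine tsum_congr fun b => ?_
    rw [wiredVertex_of_notMem b.2, wiredVertex_of_mem a.2]

instance (H : Finset V) : FiniteDimensional ℝ (N.diracSpan (H : Set V)) :=
  FiniteDimensional.span_of_finite ℝ (H.finite_toSet.image _)

/-- A gradient satisfies the dipole equation on `S` iff it differs from a representative of
the difference of the values at `x` and `y` by an element orthogonal to the gradients of Dirac
masses on `S`. -/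
theorem laplacian_eq_dipole_iff {x y : V} {η : EdgeSpace V}
    (hη : ∀ v : N.finiteEnergySubmodule, inner ℝ η (N.grad v) = 2 * (v.1 x - v.1 y))
    (S : Set V) (v : N.finiteEnergySubmodule) :
    (∀ z ∈ S, laplacian N.c v z = dirac x z - dirac y z) ↔
      ∀ w ∈ N.diracSpan S, inner ℝ (η - N.grad v) w = 0 := by
  have key : ∀ z, inner ℝ (η - N.grad v) (N.diracGrad z) =
      2 * (dirac x z - dirac y z - laplacian N.c v z) := fun z => by
    rw [inner_sub_left, inner_grad_diracGrad, diracGrad, hη, dirac_comm x z, dirac_comm y z]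
    ring
  constructor
  · intro h w hw
    induction hw using Submodule.span_induction with
    | mem w hw =>
      obtain ⟨z, hz, rfl⟩ := hw
      rw [key, h z hz, sub_self, mul_zero]
    | zero => exact inner_zero_right _
    | add a b _ _ ha hb => rw [inner_add_right, ha, hb, add_zero]
    | smul r a _ ha => rw [inner_smul_right, ha, mul_zero]
  · intro h z hz
    have := h _ (Submodule.subset_span ⟨z, hz, rfl⟩)
    rw [key] at this
    linarith

/-- The projection of `η` yields a solution, and the pulled-back gradient of any solution is that
projection, so the set defining the resistance is a singleton. -/
theorem wiredSubnetworkResistance_eq {x y : V} {η : EdgeSpace V}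
    (hη : ∀ v : N.finiteEnergySubmodule, inner ℝ η (N.grad v) = 2 * (v.1 x - v.1 y))
    {H : Finset V} (hx : x ∈ H) (hy : y ∈ H) :
    wiredSubnetworkResistance N.c H x y =
      1 / 2 * inner ℝ η ((N.diracSpan (H : Set V)).starProjection η) := by
  set P := (N.diracSpan (H : Set V)).starProjection η with hP
  have hdirac : ∀ {u : V} (_ : u ∈ H) (a : {a // a ∈ H}),
      dirac (wiredVertex H u) (some a) = dirac u a.1 := fun {u} hu a => by
    classical
    simp [dirac_apply, wiredVertex_of_mem hu, Subtype.ext_iff]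
  rw [wiredSubnetworkResistance, effectiveResistance]
  refine Eq.trans (congrArg sInf ?_) (csInf_singleton _)
  rw [Set.eq_singleton_iff_unique_mem]
  constructor
  · obtain ⟨v, hv, -, hvH⟩ := N.exists_of_mem_diracSpan
      ((N.diracSpan (H : Set V)).starProjection_apply_mem η)
    have hlift : (fun z => (fun a : Option {a // a ∈ H} => a.elim 0 fun b => v.1 b)
        (wiredVertex H z)) = v.1 := by
      ext z
      by_cases hz : z ∈ H
      · simp [wiredVertex_of_mem hz]
      · simp [wiredVertex_of_notMem hz, hvH z hz]
    refine ⟨fun a => a.elim 0 fun b => v.1 b, ?_, ?_⟩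
    · have hsome : ∀ a : {a // a ∈ H},
          laplacian (wiredConductance N.c H) (fun a => a.elim 0 fun b => v.1 b) (some a) =
          dirac (wiredVertex H x) (some a) - dirac (wiredVertex H y) (some a) := fun a => by
        rw [laplacian_wired_some, hlift, hdirac hx, hdirac hy]
        refine (N.laplacian_eq_dipole_iff hη H v).2 (fun w hw => ?_) a a.2
        rw [hv]
        exact Submodule.starProjection_inner_eq_zero _ _ hw
      rintro (_ | a)
      -- The equation at `∞` follows from those on `H`, as both sides sum to zero over the finite
      -- network.
      · have h1 := sum_laplacian_eq_zero (wiredConductance_comm N.symm H)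
          (fun a => a.elim 0 fun b => v.1 b)
        have h2 := sum_dirac (wiredVertex H x)
        have h3 := sum_dirac (wiredVertex H y)
        rw [Fintype.sum_option] at h1 h2 h3
        rw [Finset.sum_congr rfl fun a _ => hsome a, Finset.sum_sub_distrib] at h1
        linarith
      · exact hsome a
    · rw [hP, ← hv, hη, wiredVertex_of_mem hx, wiredVertex_of_mem hy]
      simp
  · rintro d ⟨g, hg, rfl⟩
    obtain ⟨hmem, hspan⟩ := N.grad_mem_diracSpan_of_finset H (v := fun z => g (wiredVertex H z))
      (k := g none) fun z hz => by rw [wiredVertex_of_notMem hz]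
    have hproj : P = N.grad ⟨_, hmem⟩ := by
      refine Submodule.eq_starProjection_of_mem_of_inner_eq_zero hspan ?_
      refine (N.laplacian_eq_dipole_iff hη H _).1 fun z hz => ?_
      have := hg (some ⟨z, hz⟩)
      rwa [laplacian_wired_some, hdirac hx, hdirac hy] at this
    rw [hproj, hη]
    ring

theorem tendsto_wiredSubnetworkResistance {x y : V} {η : EdgeSpace V}
    (hη : ∀ v : N.finiteEnergySubmodule, inner ℝ η (N.grad v) = 2 * (v.1 x - v.1 y))
    {G : ℕ → Finset V} (hmono : Monotone G) (hG : ∀ z, ∃ k, z ∈ G k) :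
    Tendsto (fun k => wiredSubnetworkResistance N.c (G k) x y) atTop
      (𝓝 (1 / 2 * inner ℝ η (N.finClosure.starProjection η))) := by
  have hsup : ⨆ k, N.diracSpan (G k : Set V) = N.diracSpan Set.univ := by
    simp only [diracSpan]
    rw [← Submodule.span_iUnion, ← Set.image_iUnion]
    congr 2
    exact Set.eq_univ_of_forall fun z => Set.mem_iUnion.2 (hG z)
  have hcl : (⨆ k, N.diracSpan (G k : Set V)).topologicalClosure = N.finClosure := by
    rw [hsup, finClosure]
  have : (⨆ k, N.diracSpan (G k : Set V)).topologicalClosure.HasOrthogonalProjection := by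
    rw [hcl]
    infer_instance
  have hproj := Submodule.starProjection_tendsto_closure_iSup
    (fun k => N.diracSpan (G k : Set V)) (fun i j hij => N.diracSpan_mono (hmono hij)) η
  simp only [hcl] at hproj
  have hlim := ((tendsto_const_nhds (x := η)).inner hproj (𝕜 := ℝ)).const_mul (1 / 2 : ℝ)
  refine hlim.congr' ?_
  -- The projection formula needs `x` and `y` inside `G k`, which holds eventually.
  obtain ⟨i, hi⟩ := hG x
  obtain ⟨j, hj⟩ := hG y
  filter_upwards [eventually_ge_atTop i, eventually_ge_atTop j] with k hik hjk
  rw [N.wiredSubnetworkResistance_eq hη (hmono hik hi) (hmono hjk hj)]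

/-! ### Existence of exhaustions -/

/-- A summable family has countable support, so each vertex has countably many neighbours;
connectedness does the rest. -/
theorem countable_vertices {V : Type*} (N : Network V) : Countable V := by
  obtain ⟨o⟩ := N.connected.nonempty
  let S : ℕ → Set V := fun n => Nat.rec {o} (fun _ s => ⋃ x ∈ s, {y | N.c x y ≠ 0}) n
  have hS : ∀ n, (S n).Countable := fun n => by
    induction n with
    | zero => exact Set.countable_singleton o
    | succ n ih => exact ih.biUnion fun x _ => (N.summable x).countable_support
  have hwalk : ∀ {a b : V} (_ : (conductanceGraph N.c).Walk a b) (n : ℕ), a ∈ S n →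
      b ∈ ⋃ n, S n := by
    intro a b p
    induction p with
    | nil => exact fun n h => Set.mem_iUnion.2 ⟨n, h⟩
    | @cons a d b hab _ ih =>
      exact fun n h => ih (n + 1) (Set.mem_biUnion h (N.adj_pos hab).ne')
  have huniv : (⋃ n, S n) = Set.univ := Set.eq_univ_of_forall fun z => by
    obtain ⟨p⟩ := N.connected.preconnected o z
    exact hwalk p 0 rfl
  rw [← Set.countable_univ_iff, ← huniv]
  exact Set.countable_iUnion hS

/-- Finite unions of walks issuing from one root are connected through that root. -/
theorem exists_isExhaustion : ∃ G, IsExhaustion N.c G := by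
  classical
  have := N.countable_vertices
  have := N.connected.nonempty
  obtain ⟨e, he⟩ := exists_surjective_nat V
  let o : V := e 0
  have p : ∀ z, (conductanceGraph N.c).Walk o z := fun z =>
    (N.connected.preconnected o z).some
  refine ⟨fun k => (Finset.range (k + 1)).biUnion fun i => (p (e i)).support.toFinset,
    fun i j hij => Finset.biUnion_subset_biUnion_of_subset_left _
      (Finset.range_mono (by omega)), fun k => ?_, fun z => ?_⟩
  · refine SimpleGraph.induce_connected_of_patches o ?_ fun {v} hv => ?_
    · simp only [Finset.coe_biUnion, Set.mem_iUnion]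
      exact ⟨0, by simp, by simp⟩
    · simp only [Finset.coe_biUnion, Set.mem_iUnion] at hv
      obtain ⟨i, hi, hv⟩ := hv
      refine ⟨{v | v ∈ (p (e i)).support}, fun a ha => ?_, (p (e i)).start_mem_support,
        by simpa using hv, (p (e i)).connected_induce_support.preconnected _ _⟩
      simp only [Finset.coe_biUnion, Set.mem_iUnion]
      exact ⟨i, hi, by simpa using ha⟩
  · obtain ⟨i, rfl⟩ := he z
    exact ⟨i, Finset.mem_biUnion.2 ⟨i, by simp, by simp⟩⟩

/-! ### Flows and the dipole in `Fin` -/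

/-- Dividing by `√c` places flows in the same space as gradients; the current `c (v s - v t)` goes
to `grad v`. -/
theorem dissipation_eq_norm_sq {I : V → V → ℝ} (hfin : FiniteDissipation N.c I) :
    ∃ w : EdgeSpace V, (∀ p, w p = (√(N.c p.1 p.2))⁻¹ * I p.1 p.2) ∧
      dissipation N.c I = 1 / 2 * ‖w‖ ^ 2 := by
  have hsq : ∀ p : V × V, ((√(N.c p.1 p.2))⁻¹ * I p.1 p.2) ^ 2 =
      (N.c p.1 p.2)⁻¹ * I p.1 p.2 ^ 2 := fun p => by
    rw [mul_pow, inv_pow, Real.sq_sqrt (N.nonneg _ _)]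
  have hmem : Memℓp (fun p : V × V => (√(N.c p.1 p.2))⁻¹ * I p.1 p.2) 2 :=
    memℓp_two_iff.2 (hfin.congr fun p => (hsq p).symm)
  refine ⟨⟨_, hmem⟩, fun p => rfl, ?_⟩
  rw [← real_inner_self_eq_norm_sq, inner_lp_eq, dissipation]
  congr 1
  refine tsum_congr fun p => ?_
  rw [← hsq, sq]

/-- An element of the edge space orthogonal to the gradients of all Dirac masses is orthogonal
to the closure of their span. -/
theorem inner_eq_zero_of_mem_finClosure {w : EdgeSpace V}
    (hw : ∀ z, inner ℝ w (N.diracGrad z) = 0) {k : EdgeSpace V} (hk : k ∈ N.finClosure) :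
    inner ℝ w k = 0 := by
  have hle : N.finClosure ≤ (Submodule.span ℝ {w})ᗮ := by
    refine Submodule.topologicalClosure_minimal _ ?_ (Submodule.isClosed_orthogonal _)
    refine Submodule.span_le.2 ?_
    rintro _ ⟨z, -, rfl⟩
    exact Submodule.mem_orthogonal_singleton_iff_inner_right.2 (hw z)
  exact Submodule.mem_orthogonal_singleton_iff_inner_right.1 (hle hk)

/-- The dipole in the closure of the finitely supported functions. -/
theorem exists_finDipole (x y : V) : ∃ f : N.finiteEnergySubmodule,
    N.grad f ∈ N.finClosure ∧ IsDipole N.c x y f ∧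
    (∀ u : N.finiteEnergySubmodule, N.grad u ∈ N.finClosure →
      inner ℝ (N.grad f) (N.grad u) = 2 * (u.1 x - u.1 y)) ∧
    (∀ u : N.finiteEnergySubmodule, N.grad u = N.grad f → u.1 x - u.1 y = f.1 x - f.1 y) ∧
    IsWiredResistance N.c x y (f.1 x - f.1 y) := by
  obtain ⟨η₀, hη₀⟩ := N.exists_inner_eq_sub x y
  obtain ⟨η, hη⟩ : ∃ η : EdgeSpace V, ∀ v : N.finiteEnergySubmodule,
      inner ℝ η (N.grad v) = 2 * (v.1 x - v.1 y) :=
    ⟨(2 : ℝ) • η₀, fun v => by rw [real_inner_smul_left, hη₀]⟩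
  have hP := N.finClosure.starProjection_apply_mem η
  obtain ⟨f, hf⟩ := N.exists_grad_eq_of_mem_finClosure hP
  have horth : ∀ w ∈ N.finClosure, inner ℝ (η - N.grad f) w = 0 := fun w hw => by
    rw [hf]
    exact Submodule.starProjection_inner_eq_zero _ _ hw
  refine ⟨f, hf ▸ hP, ⟨f.2, fun z => ?_⟩, fun u hu => ?_, fun u hu => ?_,
    N.exists_isExhaustion, fun G hG => ?_⟩
  · exact (N.laplacian_eq_dipole_iff hη Set.univ f).2
      (fun w hw => horth w (Submodule.le_topologicalClosure _ hw)) z trivial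
  · have := horth _ hu
    rw [inner_sub_left, hη] at this
    linarith
  · have h1 := hη u
    rw [hu, hη] at h1
    linarith
  · have := N.tendsto_wiredSubnetworkResistance hη hG.mono hG.exhausts
    rw [← hf, hη] at this
    convert this using 2
    ring

end Network
end ResistanceNetwork

end

/-! ### The characterizations of the wired resistance -/

theorem mainTheorem2 {V : Type*} (N : ResistanceNetwork.Network V) (x y : V) :
    ∃ R : ℝ, ResistanceNetwork.IsWiredResistance N.c x y R ∧
      -- voltage drop of the solutions in `Fin` (they exist, and all have the drop `R`)
      {d : ℝ | ∃ v ∈ ResistanceNetwork.FinSpace N.c,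
        ResistanceNetwork.IsDipole N.c x y v ∧ d = v x - v y} = {R} ∧
      -- voltage drop of the finite-energy solutions of minimal energy
      (∀ v, ResistanceNetwork.IsDipole N.c x y v →
        (∀ u, ResistanceNetwork.IsDipole N.c x y u →
          ResistanceNetwork.energy N.c v ≤ ResistanceNetwork.energy N.c u) →
        v x - v y = R) ∧
      -- minimal voltage drop over all finite-energy solutions, when it is bounded below
      ((∀ h, ResistanceNetwork.IsHarmonic N.c h → h x = h y) →
        IsLeast {d : ℝ | ∃ v, ResistanceNetwork.IsDipole N.c x y v ∧ d = v x - v y} R) ∧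
      -- minimal energy over all finite-energy solutions
      IsLeast {e : ℝ | ∃ v, ResistanceNetwork.IsDipole N.c x y v ∧
        e = ResistanceNetwork.energy N.c v} R ∧
      -- minimal dissipation over all unit flows of finite dissipation
      IsLeast {d : ℝ | ∃ I, ResistanceNetwork.IsFlow N.c x y I ∧
        ResistanceNetwork.FiniteDissipation N.c I ∧
        d = ResistanceNetwork.dissipation N.c I} R ∧
      -- reciprocal of the minimal energy over functions in `Fin` with boundary values 1 and 0
      (x ≠ y → 0 < R ∧ ∃ m : ℝ,
        IsLeast {e : ℝ | ∃ u ∈ ResistanceNetwork.FinSpace N.c, u x = 1 ∧ u y = 0 ∧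
          e = ResistanceNetwork.energy N.c u} m ∧ R = 1 / m) ∧
      -- squared norm of the functional `v ↦ v x - v y` on `Fin`, in two forms
      IsGLB {κ : ℝ | 0 ≤ κ ∧ ∀ v ∈ ResistanceNetwork.FinSpace N.c,
        |v x - v y| ^ 2 ≤ κ * ResistanceNetwork.energy N.c v} R ∧
      IsLUB {d : ℝ | ∃ v ∈ ResistanceNetwork.FinSpace N.c,
        ResistanceNetwork.energy N.c v ≤ 1 ∧ d = |v x - v y| ^ 2} R := by
  open ResistanceNetwork in
  obtain ⟨f, hfF, hfd, hpair, hdrop, hwired⟩ := N.exists_finDipole x y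
  set R := f.1 x - f.1 y with hR
  have hnorm : ‖N.grad f‖ ^ 2 = 2 * R := by
    rw [← real_inner_self_eq_norm_sq, hpair f hfF]
  have hE : energy N.c f = R := by
    rw [N.energy_eq_norm_sq, hnorm]
    ring
  have hR0 : 0 ≤ R := by nlinarith [sq_nonneg ‖N.grad f‖]
  have hfin : f.1 ∈ FinSpace N.c := (N.mem_finSpace_iff f).2 hfF
  have hfz : ∀ z, inner ℝ (N.grad f) (N.diracGrad z) = 2 * (dirac x z - dirac y z) := fun z => by
    rw [N.inner_grad_diracGrad, hfd.2]
  -- Stated for arbitrary `w` with the divergence of a dipole, so that it serves both gradients and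
  -- flows.
  have hperp : ∀ w : EdgeSpace V,
      (∀ z, inner ℝ w (N.diracGrad z) = 2 * (dirac x z - dirac y z)) →
      ∀ k ∈ N.finClosure, inner ℝ (w - N.grad f) k = 0 := fun w hw k hk =>
    N.inner_eq_zero_of_mem_finClosure
      (fun z => by rw [inner_sub_left, hw, hfz, sub_self]) hk
  have hpyth : ∀ w : EdgeSpace V,
      (∀ z, inner ℝ w (N.diracGrad z) = 2 * (dirac x z - dirac y z)) →
      ‖w‖ ^ 2 = ‖w - N.grad f‖ ^ 2 + 2 * R := fun w hw => by
    have h := norm_add_sq_eq_norm_sq_add_norm_sq_real (hperp w hw _ hfF)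
    rw [sub_add_cancel] at h
    rw [← hnorm]
    linarith
  have hdip : ∀ v : N.finiteEnergySubmodule, IsDipole N.c x y v →
      ∀ z, inner ℝ (N.grad v) (N.diracGrad z) = 2 * (dirac x z - dirac y z) := fun v hv z => by
    rw [N.inner_grad_diracGrad, hv.2]
  have hCS : ∀ v ∈ FinSpace N.c, |v x - v y| ^ 2 ≤ R * energy N.c v := fun v hv => by
    have hv' := (N.mem_finSpace_iff ⟨v, hv.1⟩).1 hv
    have h1 := real_inner_mul_inner_self_le (N.grad f) (N.grad ⟨v, hv.1⟩)
    have h2 := N.energy_eq_norm_sq ⟨v, hv.1⟩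
    rw [real_inner_self_eq_norm_sq, real_inner_self_eq_norm_sq, hpair _ hv', hnorm] at h1
    rw [sq_abs, h2]
    nlinarith
  have hsmul : ∀ a : ℝ, a • f.1 ∈ FinSpace N.c ∧ energy N.c (a • f.1) = a ^ 2 * R := fun a => by
    refine ⟨(N.mem_finSpace_iff (a • f)).2 ?_, ?_⟩
    · rw [map_smul]
      exact Submodule.smul_mem _ _ hfF
    · have h := N.energy_eq_norm_sq (a • f)
      rw [map_smul, norm_smul, mul_pow, hnorm, Real.norm_eq_abs, sq_abs] at h
      exact h.trans (by ring)
  refine ⟨R, hwired, ?_, ?_, ?_, ⟨⟨f, hfd, hE.symm⟩, ?_⟩, ⟨?_, ?_⟩, ?_, ⟨?_, ?_⟩, ⟨?_, ?_⟩⟩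
  · refine Set.eq_singleton_iff_unique_mem.2 ⟨⟨f, hfin, hfd, hR⟩, ?_⟩
    rintro d ⟨v, hvF, hvd, rfl⟩
    -- The difference of the two gradients lies in the closure and is orthogonal to it.
    refine hdrop ⟨v, hvF.1⟩ (sub_eq_zero.1 (inner_self_eq_zero (𝕜 := ℝ).1 ?_))
    exact hperp _ (hdip ⟨v, hvF.1⟩ hvd) _
      (Submodule.sub_mem _ ((N.mem_finSpace_iff ⟨v, hvF.1⟩).1 hvF) hfF)
  · intro v hvd hmin
    refine hdrop ⟨v, hvd.1⟩ (sub_eq_zero.1 (norm_eq_zero.1 ?_))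
    have h1 := hmin f hfd
    have h2 := N.energy_eq_norm_sq ⟨v, hvd.1⟩
    have h3 := hpyth _ (hdip ⟨v, hvd.1⟩ hvd)
    refine pow_eq_zero_iff two_ne_zero |>.1 (le_antisymm ?_ (sq_nonneg _))
    linarith
  · intro hharm
    refine ⟨⟨f, hfd, hR⟩, ?_⟩
    rintro d ⟨v, hvd, rfl⟩
    -- Two dipoles differ by a harmonic function, so here all of them have the same drop.
    have := hharm ((⟨v, hvd.1⟩ : N.finiteEnergySubmodule) - f : N.finiteEnergySubmodule)
      ⟨Subtype.property _, fun z => ?_⟩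
    · simp only [Submodule.coe_sub, Pi.sub_apply] at this
      linarith
    · have h := N.inner_grad_diracGrad (⟨v, hvd.1⟩ - f) z
      rw [map_sub, inner_sub_left, hdip ⟨v, hvd.1⟩ hvd, hfz, sub_self] at h
      linarith
  · rintro e ⟨v, hvd, rfl⟩
    have h2 := N.energy_eq_norm_sq ⟨v, hvd.1⟩
    have h3 := hpyth _ (hdip ⟨v, hvd.1⟩ hvd)
    have h4 := sq_nonneg ‖N.grad ⟨v, hvd.1⟩ - N.grad f‖
    linarith
  · have hterm : ∀ p : V × V, (N.c p.1 p.2)⁻¹ * (N.c p.1 p.2 * (f.1 p.1 - f.1 p.2)) ^ 2 =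
        N.c p.1 p.2 * (f.1 p.1 - f.1 p.2) ^ 2 := fun p => by
      rcases eq_or_ne (N.c p.1 p.2) 0 with h | h
      · simp [h]
      · field_simp
    refine ⟨fun s t => N.c s t * (f.1 s - f.1 t), ⟨⟨fun s t => ?_, fun s t h => ?_⟩, hfd.2⟩,
      hfd.1.congr fun p => (hterm p).symm, ?_⟩
    · rw [N.symm t s]
      ring
    · simp [h]
    · rw [← hE, energy, dissipation]
      congr 1
      exact (tsum_congr hterm).symm
  · rintro d ⟨I, hI, hIfin, rfl⟩
    obtain ⟨w, hw, hdiss⟩ := N.dissipation_eq_norm_sq hIfin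
    have hwz : ∀ z, inner ℝ w (N.diracGrad z) = 2 * (dirac x z - dirac y z) := fun z => by
      rw [N.inner_diracGrad, ← hI.2 z]
      · congr 1
        refine tsum_congr fun t => ?_
        rw [hw]
        rcases eq_or_ne (N.c z t) 0 with h | h
        · simp [h, hI.1.supported z t h]
        · have := (Real.sqrt_ne_zero (N.nonneg z t)).2 h
          field_simp
      · intro s t
        rw [hw, hw, N.symm t s, hI.1.antisymm s t]
        ring
    have h3 := hpyth w hwz
    have h4 := sq_nonneg ‖w - N.grad f‖
    linarith
  · intro hxy
    have hpos : 0 < R := by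
      refine lt_of_le_of_ne hR0 fun h0 => ?_
      have hg : N.grad f = 0 := by
        rw [← norm_eq_zero, ← pow_eq_zero_iff two_ne_zero, hnorm, ← h0, mul_zero]
      have := hfz x
      classical
      rw [hg, inner_zero_left, dirac_apply, dirac_apply, if_pos rfl, if_neg hxy] at this
      norm_num at this
    refine ⟨hpos, 1 / R, ⟨?_, ?_⟩, (one_div_one_div R).symm⟩
    -- Rescaling `f` to drop 1 and shifting it to vanish at `y` gives energy `R⁻² R = 1 / R`.
    · let u : N.finiteEnergySubmodule := R⁻¹ • f - ⟨fun _ => R⁻¹ * f.1 y, N.const_mem _⟩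
      have hu : N.grad u = R⁻¹ • N.grad f := by
        rw [map_sub, N.grad_const, sub_zero, map_smul]
      refine ⟨u, (N.mem_finSpace_iff u).2 ?_, ?_, ?_, ?_⟩
      · rw [hu]
        exact Submodule.smul_mem _ _ hfF
      · change R⁻¹ * f.1 x - R⁻¹ * f.1 y = 1
        rw [← mul_sub, ← hR, inv_mul_cancel₀ hpos.ne']
      · exact sub_self _
      · rw [N.energy_eq_norm_sq, hu, norm_smul, mul_pow, hnorm, Real.norm_eq_abs, sq_abs]
        field_simp
    · rintro e ⟨u, huF, hux, huy, rfl⟩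
      have := hCS u huF
      rw [hux, huy] at this
      rw [div_le_iff₀ hpos]
      norm_num at this
      linarith
  · rintro κ ⟨hκ, h⟩
    rcases hR0.eq_or_lt with h0 | hpos
    · rwa [← h0]
    · have := h f hfin
      rw [hE, ← hR, sq_abs, sq] at this
      exact le_of_mul_le_mul_right this hpos
  · exact fun b hb => hb ⟨hR0, hCS⟩
  · rintro d ⟨v, hvF, hv1, rfl⟩
    exact (hCS v hvF).trans (mul_le_of_le_one_right hR0 hv1)
  · intro b hb
    -- For `R > 0` this multiple of `f` has energy 1 and squared drop `R`; for `R = 0` the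
    -- convention `0⁻¹ = 0` makes it the zero function, which still suffices.
    obtain ⟨h1, h2⟩ := hsmul (√R)⁻¹
    rw [inv_pow, Real.sq_sqrt hR0] at h2
    have := hb ⟨_, h1, h2.trans_le inv_mul_le_one, rfl⟩
    simp only [Pi.smul_apply, smul_eq_mul, ← mul_sub, ← hR, sq_abs, mul_pow, inv_pow,
      Real.sq_sqrt hR0] at this
    rcases hR0.eq_or_lt with h0 | hpos
    · simpa [← h0] using this
    · rwa [sq, inv_mul_cancel_left₀ hpos.ne'] at this
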